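/- Let $(\mathcal{A}_g)_{g\ge 0}$ be the Apollonian networks, defined as follows. $\mathcal{A}_0$ is the complete graph on four nodes (a tetrahedron), and its four triangles are the triangles generated at iteration $0$. For $g\ge 1$, $\mathcal{A}_g$ is obtained from $\mathcal{A}_{g-1}$ by adding, for each triangle generated at iteration $g-1$, one new node joined to exactly the three nodes of this triangle; the triangles generated at iteration $g$ are those that contain a node added at iteration $g$ (three for each new node). For a finite connected graph $\mathcal{G}$, consider the simple random walk on $\mathcal{G}$, which at each step moves to a uniformly chosen neighbour of its current node. Let $C_u$ be the expected number of steps that the walk started at the node $u$ needs to visit every node of $\mathcal{G}$, and let the cover time of $\mathcal{G}$ be $C(\mathcal{G})=\max_u C_u$. **Theorem.** For every $g\ge 0$ the network $\mathcal{A}_g$ has $N_g=2\cdot 3^g+2$ nodes, and its cover time scales as $N_g\log N_g$, that is, $C(\mathcal{A}_g)=\Theta(N_g\log N_g)$: there are constants $c,c'>0$, independent of $g$, such that for all $g\ge 0$ $$c\,N_g\log N_g\;\le\; C(\mathcal{A}_g)\;\le\; c'\,N_g\log N_g .$$ -/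

import Mathlib

open MeasureTheory ProbabilityTheory
open scoped ENNReal

namespace Apollonian

/-- Index type of the triangles generated at iteration `g`: the four triangles of the tetrahedron
for `g = 0`; afterwards, every triangle `t` gives rise to three new triangles `(t, 0)`, `(t, 1)`,
`(t, 2)`. -/
def Tri : ℕ → Type
  | 0 => Fin 4
  | g + 1 => Tri g × Fin 3

/-- Nodes after `g` iterations: the four nodes of the tetrahedron for `g = 0`; afterwards, the old
nodes (`Sum.inl`) together with one new node (`Sum.inr`) for each triangle generated at the
previous iteration. -/
def Node : ℕ → Type
  | 0 => Fin 4
  | g + 1 => Node g ⊕ Tri g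

/-- The three nodes of a triangle generated at iteration `g`. For `g = 0` the triangle `i` consists
of the three nodes other than `i`. Afterwards, the triangle `(t, k)` is formed by the new node
placed in `t` and the two nodes of `t` other than the `k`-th one. -/
def corner : (g : ℕ) → Tri g → Fin 3 → Node g
  | 0 => fun i j => Fin.succAbove (n := 3) i j
  | g + 1 => fun s j => if j = s.2 then Sum.inr s.1 else Sum.inl (corner g s.1 j)

/-- Adjacency: the tetrahedron for `g = 0`; afterwards, old nodes keep their adjacency, and each new
node is joined exactly to the three nodes of the triangle it was created for. -/
def Adj : (g : ℕ) → Node g → Node g → Prop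
  | 0 => fun x y => x ≠ y
  | g + 1 => fun x y =>
    match x, y with
    | Sum.inl u, Sum.inl v => Adj g u v
    | Sum.inl u, Sum.inr t => ∃ j, corner g t j = u
    | Sum.inr t, Sum.inl u => ∃ j, corner g t j = u
    | Sum.inr _, Sum.inr _ => False

theorem adj_symm : (g : ℕ) → ∀ x y : Node g, Adj g x y → Adj g y x
  | 0 => fun _ _ h => Ne.symm h
  | g + 1 => fun x y h =>
    match x, y, h with
    | Sum.inl u, Sum.inl v, h => adj_symm g u v h
    | Sum.inl _, Sum.inr _, h => h
    | Sum.inr _, Sum.inl _, h => h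

theorem adj_irrefl : (g : ℕ) → ∀ x : Node g, ¬ Adj g x x
  | 0 => fun _ h => h rfl
  | g + 1 => fun x h =>
    match x, h with
    | Sum.inl u, h => adj_irrefl g u h

/-- The Apollonian network after `g` iterations. -/
def network (g : ℕ) : SimpleGraph (Node g) where
  Adj := Adj g
  symm := ⟨adj_symm g⟩
  loopless := ⟨adj_irrefl g⟩

instance instFintypeTri : (g : ℕ) → Fintype (Tri g)
  | 0 => inferInstanceAs (Fintype (Fin 4))
  | g + 1 => @instFintypeProd (Tri g) (Fin 3) (instFintypeTri g) _

instance instFintypeNode : (g : ℕ) → Fintype (Node g)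
  | 0 => inferInstanceAs (Fintype (Fin 4))
  | g + 1 => @instFintypeSum (Node g) (Tri g) (instFintypeNode g) (instFintypeTri g)

instance instMeasurableSpaceNode (g : ℕ) : MeasurableSpace (Node g) := ⊤

instance instDiscreteMeasurableSpaceNode (g : ℕ) : DiscreteMeasurableSpace (Node g) :=
  ⟨fun _ => trivial⟩

end Apollonian

namespace RandomWalk

variable {V : Type*} [Fintype V]

open Classical in
/-- One step of the simple random walk on `G` from `u`: the next node is uniform among the
neighbours of `u` (by convention the walk stays at `u` if `u` is isolated). -/
noncomputable def step (G : SimpleGraph V) (u : V) : PMF V :=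
  if h : (G.neighborFinset u).Nonempty then PMF.uniformOfFinset (G.neighborFinset u) h
  else PMF.pure u

variable [MeasurableSpace V] [DiscreteMeasurableSpace V]

/-- The transition kernel of the simple random walk on `G`. -/
noncomputable def stepKernel (G : SimpleGraph V) : Kernel V V :=
  Kernel.ofFunOfCountable fun u => (step G u).toMeasure

instance instIsMarkovKernelStepKernel (G : SimpleGraph V) : IsMarkovKernel (stepKernel G) :=
  ⟨fun u => PMF.toMeasure.isProbabilityMeasure (step G u)⟩

/-- The law of the next node given the path `(x 0, …, x n)` up to time `n`: it depends on the current
node `x n` only. -/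
noncomputable def pathKernel (G : SimpleGraph V) (n : ℕ) :
    Kernel ((i : Finset.Iic n) → (fun _ : ℕ => V) i) ((fun _ : ℕ => V) (n + 1)) :=
  (stepKernel G).comap (fun x => x ⟨n, Finset.mem_Iic.2 le_rfl⟩) (measurable_pi_apply _)

instance instIsMarkovKernelPathKernel (G : SimpleGraph V) (n : ℕ) :
    IsMarkovKernel (pathKernel G n) := by
  unfold pathKernel; infer_instance

/-- The law, on the space of infinite trajectories, of the simple random walk on `G` started at `u`
at time `0`. -/
noncomputable def walkLaw (G : SimpleGraph V) (u : V) : Measure (ℕ → V) :=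
  Kernel.trajMeasure (X := fun _ : ℕ => V) (Measure.dirac u) (pathKernel G)

/-- The number of steps after which the trajectory `ω` has visited every node (`∞` if it never
does). -/
noncomputable def coverStep {V : Type*} (ω : ℕ → V) : ℝ≥0∞ :=
  ⨅ (n : ℕ) (_ : ∀ v, ∃ k ≤ n, ω k = v), (n : ℝ≥0∞)

/-- The cover time from `u`: the expected number of steps that the walk started at `u` needs to
visit every node. -/
noncomputable def coverTimeFrom (G : SimpleGraph V) (u : V) : ℝ≥0∞ :=
  ∫⁻ ω, coverStep ω ∂(walkLaw G u)

/-- The cover time of `G`: the maximum over all starting nodes of the cover time from that node. -/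
noncomputable def coverTime (G : SimpleGraph V) : ℝ≥0∞ :=
  ⨆ u, coverTimeFrom G u

end RandomWalk

/-! Matthews' method reduces the cover time to hitting times. If every node is hit from everywhere
in expected time at most `M`, covering takes at most `M` times a harmonic number of the number of
nodes. If each node of a set `A` needs expected time at least `h` from everywhere else, covering
takes at least `h` times the harmonic number of `A.card`. Both bounds come from one potential of the
pair (unvisited set, current node): `matthews` combines the mean of the hitting times of the
unvisited nodes with a harmonic correction, and its drift is compared with `-1`
(`coverTimeFrom_le_of_potential`, `le_coverTimeFrom_of_potential`).

For Apollonian networks both `M` and `h` are of order `3 ^ g`. Upper bound: supersolutions for an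
old target extend to the next network with scale `9 / 5 < 3` (`isHittingBound_old`). A node just
added is hit by way of a corner of its triangle, at a cost bounded by the total degree `12 * 3 ^ g`
through the return-time identity (`nbrSum_target`). The resulting recursion stays below a multiple
of `3 ^ g`.

Lower bound: by the same identity the hitting times of a new node from its three corners add up to
nearly the total degree. The corners are mutually adjacent, so even the smallest of the three is of
that order (`le_of_isHittingTime_new`). The last iteration adds a positive proportion of all nodes,
which supplies `A`. -/

namespace RandomWalk

/-! ### Neighbour sums, one step of the walk, and the Markov property. -/

section Walk

variable {V : Type*} [Fintype V]

open Classical in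
/-- The sum of `f` over the neighbours of `u`. -/
noncomputable def nbrSum (G : SimpleGraph V) (f : V → ℝ) (u : V) : ℝ :=
  ∑ w, if G.Adj u w then f w else 0

/-- The degree of `u`, as a real number. -/
noncomputable def deg (G : SimpleGraph V) (u : V) : ℝ := nbrSum G (fun _ => 1) u

open Classical in
theorem nbrSum_eq_sum_neighborFinset (G : SimpleGraph V) (f : V → ℝ) (u : V) :
    nbrSum G f u = ∑ w ∈ G.neighborFinset u, f w := by
  rw [nbrSum, ← Finset.sum_filter]
  congr 1
  ext w
  simp

open Classical in
theorem deg_eq_card (G : SimpleGraph V) (u : V) : deg G u = (G.neighborFinset u).card := by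
  simp [deg, nbrSum_eq_sum_neighborFinset]

theorem nbrSum_mono (G : SimpleGraph V) {f f' : V → ℝ} (u : V)
    (h : ∀ w, G.Adj u w → f w ≤ f' w) : nbrSum G f u ≤ nbrSum G f' u := by
  refine Finset.sum_le_sum fun w _ => ?_
  split_ifs with hw
  exacts [h w hw, le_rfl]

theorem nbrSum_add (G : SimpleGraph V) (f f' : V → ℝ) (u : V) :
    nbrSum G (fun w => f w + f' w) u = nbrSum G f u + nbrSum G f' u := by
  simp only [nbrSum, ← Finset.sum_add_distrib]
  exact Finset.sum_congr rfl fun w _ => by split_ifs <;> simp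

theorem nbrSum_const_mul (G : SimpleGraph V) (c : ℝ) (f : V → ℝ) (u : V) :
    nbrSum G (fun w => c * f w) u = c * nbrSum G f u := by
  simp only [nbrSum, Finset.mul_sum, mul_ite, mul_zero]

theorem nbrSum_const (G : SimpleGraph V) (c : ℝ) (u : V) :
    nbrSum G (fun _ => c) u = c * deg G u := by
  rw [deg, ← nbrSum_const_mul]; simp

theorem nbrSum_sum (G : SimpleGraph V) {ι : Type*} (s : Finset ι) (f : ι → V → ℝ) (u : V) :
    nbrSum G (fun w => ∑ b ∈ s, f b w) u = ∑ b ∈ s, nbrSum G (f b) u := by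
  simp only [nbrSum]
  rw [Finset.sum_comm]
  exact Finset.sum_congr rfl fun w _ => by split_ifs <;> simp

variable [MeasurableSpace V] [DiscreteMeasurableSpace V]

theorem lintegral_stepKernel (G : SimpleGraph V) {u : V} (hu : 0 < deg G u) (φ : V → ℝ)
    (hφ : ∀ w, 0 ≤ φ w) :
    ∫⁻ w, ENNReal.ofReal (φ w) ∂(stepKernel G u) = ENNReal.ofReal (nbrSum G φ u / deg G u) := by
  classical
  have hne : (G.neighborFinset u).Nonempty := by
    rw [deg_eq_card] at hu
    exact Finset.card_pos.1 (by exact_mod_cast hu)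
  have hk : stepKernel G u = (PMF.uniformOfFinset (G.neighborFinset u) hne).toMeasure := by
    change (step G u).toMeasure = _
    congr 1
    rw [step, dif_pos (by convert hne)]
  rw [hk, lintegral_fintype, nbrSum, Finset.sum_div,
    ENNReal.ofReal_sum_of_nonneg fun w _ => by
      split_ifs
      exacts [div_nonneg (hφ w) hu.le, by simp]]
  refine Finset.sum_congr rfl fun w _ => ?_
  rw [PMF.toMeasure_apply_singleton _ _ (measurableSet_singleton w), PMF.uniformOfFinset_apply]
  by_cases hw : G.Adj u w
  · rw [if_pos (by simpa using hw), if_pos hw, ENNReal.ofReal_div_of_pos hu, deg_eq_card,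
      ENNReal.ofReal_natCast, div_eq_mul_inv]
  · rw [if_neg (by simpa using hw), if_neg hw]
    simp

instance instIsProbabilityMeasureWalkLaw (G : SimpleGraph V) (u : V) :
    IsProbabilityMeasure (walkLaw G u) := by
  unfold walkLaw; infer_instance

/-- The Markov property of the walk at time `n`. -/
theorem lintegral_walkLaw_succ (G : SimpleGraph V) (u : V) (n : ℕ)
    (F : ((i : Finset.Iic n) → (fun _ : ℕ => V) i) → V → ℝ≥0∞) :
    ∫⁻ ω, F (Preorder.frestrictLe n ω) (ω (n + 1)) ∂(walkLaw G u) =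
      ∫⁻ ω, ∫⁻ w, F (Preorder.frestrictLe n ω) w ∂(stepKernel G (ω n)) ∂(walkLaw G u) := by
  have hF : Measurable (fun p : ((i : Finset.Iic n) → (fun _ : ℕ => V) i) × V => F p.1 p.2) :=
    measurable_of_countable _
  have h := Kernel.map_frestrictLe_trajMeasure_compProd_eq_map_trajMeasure
    (X := fun _ : ℕ => V) (κ := pathKernel G) (μ₀ := Measure.dirac u) (a := n)
  have h1 := congrArg (fun μ => ∫⁻ p, F p.1 p.2 ∂μ) h
  rw [lintegral_map hF (by fun_prop), Measure.lintegral_compProd hF,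
    lintegral_map (measurable_of_countable _) (by fun_prop)] at h1
  exact h1.symm

theorem lintegral_walkLaw_zero (G : SimpleGraph V) (u : V) (F : V → ℝ≥0∞) :
    ∫⁻ ω, F (ω 0) ∂(walkLaw G u) = F u := by
  have h : (walkLaw G u).map (Preorder.frestrictLe (π := fun _ : ℕ => V) 0) =
      (Measure.dirac u).map (MeasurableEquiv.piUnique fun _ : Finset.Iic 0 => V).symm := by
    rw [walkLaw, Kernel.trajMeasure, Measure.map_comp _ _ (by fun_prop),
      Kernel.traj_map_frestrictLe, Kernel.partialTraj_self, Measure.id_comp]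
  have h1 := congrArg
    (fun μ => ∫⁻ p : (i : Finset.Iic 0) → V, F (p ⟨0, Finset.mem_Iic.2 le_rfl⟩) ∂μ) h
  rw [lintegral_map (measurable_of_countable _) (by fun_prop),
    lintegral_map (measurable_of_countable _) (by fun_prop),
    lintegral_dirac' _ (measurable_of_countable _)] at h1
  exact h1

end Walk

end RandomWalk

namespace RandomWalk

/-! ### The set of unvisited nodes. -/

section Remaining

variable {V : Type*}

open Classical in
/-- The nodes of `A` that the trajectory `ω` has not visited up to time `n`. -/
noncomputable def remaining (A : Finset V) (n : ℕ) (ω : ℕ → V) : Finset V :=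
  A.filter fun v => ∀ k ≤ n, ω k ≠ v

open Classical in
theorem remaining_zero (A : Finset V) (ω : ℕ → V) : remaining A 0 ω = A.erase (ω 0) := by
  ext v
  simp [remaining, and_comm, eq_comm]

open Classical in
theorem remaining_succ (A : Finset V) (n : ℕ) (ω : ℕ → V) :
    remaining A (n + 1) ω = (remaining A n ω).erase (ω (n + 1)) := by
  ext v
  simp only [remaining, Finset.mem_filter, Finset.mem_erase, Nat.le_succ_iff]
  grind

theorem notMem_remaining (A : Finset V) (n : ℕ) (ω : ℕ → V) : ω n ∉ remaining A n ω := by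
  simp only [remaining, Finset.mem_filter, not_and, not_forall]
  exact fun _ => ⟨n, le_rfl, by simp⟩

theorem remaining_subset (A : Finset V) (n : ℕ) (ω : ℕ → V) : remaining A n ω ⊆ A := by
  classical exact Finset.filter_subset _ _

theorem remaining_congr (A : Finset V) {n : ℕ} {ω ω' : ℕ → V} (h : ∀ k ≤ n, ω k = ω' k) :
    remaining A n ω = remaining A n ω' := by
  ext v
  simp only [remaining, Finset.mem_filter]
  exact and_congr_right fun _ => forall₂_congr fun k hk => by rw [h k hk]

/-- A trajectory that agrees with a given finite path. -/
def extend {n : ℕ} (y : (i : Finset.Iic n) → (fun _ : ℕ => V) i) : ℕ → V :=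
  fun k => y ⟨min k n, Finset.mem_Iic.2 (min_le_right k n)⟩

theorem extend_frestrictLe {n k : ℕ} (ω : ℕ → V) (hk : k ≤ n) :
    extend (Preorder.frestrictLe (π := fun _ : ℕ => V) n ω) k = ω k := by
  simp [extend, hk]

theorem remaining_extend (A : Finset V) (n : ℕ) (ω : ℕ → V) :
    remaining A n (extend (Preorder.frestrictLe (π := fun _ : ℕ => V) n ω)) = remaining A n ω :=
  remaining_congr A fun _ hk => extend_frestrictLe ω hk

open Classical in
/-- `1` as long as some node of `A` has not been visited, `0` afterwards. -/
noncomputable def pending (A : Finset V) (n : ℕ) (ω : ℕ → V) : ℝ≥0∞ :=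
  if (remaining A n ω).Nonempty then 1 else 0

theorem tsum_pending_le_coverStep (A : Finset V) (ω : ℕ → V) :
    ∑' n, pending A n ω ≤ coverStep ω := by
  refine le_iInf₂ fun n hn => ?_
  rw [tsum_eq_sum (s := Finset.range n)]
  · calc ∑ k ∈ Finset.range n, pending A k ω ≤ ∑ k ∈ Finset.range n, (1 : ℝ≥0∞) :=
          Finset.sum_le_sum fun k _ => by unfold pending; split_ifs <;> simp
      _ = n := by simp
  · intro k hk
    rw [Finset.mem_range, not_lt] at hk
    refine if_neg ?_
    rw [Finset.not_nonempty_iff_eq_empty]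
    classical
    refine Finset.filter_eq_empty_iff.2 fun v _ h => ?_
    obtain ⟨j, hj, hv⟩ := hn v
    exact h j (hj.trans hk) hv

/-- The cover time counts the instants at which some node is still missing. On a trajectory that
never covers, every term is `1` and the sum is infinite, in agreement with the empty infimum. -/
theorem coverStep_le_tsum_pending [Fintype V] (ω : ℕ → V) :
    coverStep ω ≤ ∑' n, pending Finset.univ n ω := by
  classical
  have key : ∀ n, (¬ ∀ v, ∃ k ≤ n, ω k = v) → pending Finset.univ n ω = 1 := by
    intro n hn
    push Not at hn
    obtain ⟨v, hv⟩ := hn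
    exact if_pos ⟨v, by simpa [remaining] using hv⟩
  by_cases h : ∃ n, ∀ v, ∃ k ≤ n, ω k = v
  · refine (iInf₂_le (Nat.find h) (Nat.find_spec h)).trans ?_
    calc ((Nat.find h : ℕ) : ℝ≥0∞) = ∑ k ∈ Finset.range (Nat.find h), 1 := by simp
      _ = ∑ k ∈ Finset.range (Nat.find h), pending Finset.univ k ω :=
          Finset.sum_congr rfl fun k hk =>
            (key k (Nat.find_min h (Finset.mem_range.1 hk))).symm
      _ ≤ _ := ENNReal.sum_le_tsum _
  · rw [tsum_congr fun n => key n fun hn => h ⟨n, hn⟩]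
    simp

end Remaining

/-! ### Drift conditions that bound the cover time. -/

section Potential

variable {V : Type*} [Fintype V] [MeasurableSpace V] [DiscreteMeasurableSpace V]

theorem measurable_of_finite_past {α : Type*} [MeasurableSpace α] (n : ℕ)
    (F : ((i : Finset.Iic n) → (fun _ : ℕ => V) i) → α) :
    Measurable fun ω : ℕ → V => F (Preorder.frestrictLe n ω) :=
  (measurable_of_countable F).comp (by fun_prop)

/-- Only the first `n + 1` positions matter, and on the countable discrete space of finite paths
every function is measurable; `extend` serves to factor through that space. -/
theorem measurable_remaining {α : Type*} [MeasurableSpace α] (A : Finset V) (n : ℕ)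
    (F : Finset V → V → α) : Measurable fun ω : ℕ → V => F (remaining A n ω) (ω n) := by
  have h := measurable_of_finite_past (V := V) n fun y => F (remaining A n (extend y)) (extend y n)
  simpa only [remaining_extend, extend_frestrictLe _ le_rfl] using h

theorem measurable_pending (A : Finset V) (n : ℕ) : Measurable (pending (V := V) A n) := by
  classical
  exact measurable_remaining A n fun R _ => if R.Nonempty then 1 else 0

-- The pair (unvisited set, current node) is itself a Markov chain, so a potential of this pair can
-- be averaged over a single step.
open Classical in
theorem lintegral_remaining_succ (G : SimpleGraph V) (hG : ∀ u, 0 < deg G u) (u : V)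
    (A : Finset V) (Φ : Finset V → V → ℝ) (hΦ : ∀ R w, 0 ≤ Φ R w) (n : ℕ) :
    ∫⁻ ω, ENNReal.ofReal (Φ (remaining A (n + 1) ω) (ω (n + 1))) ∂(walkLaw G u) =
      ∫⁻ ω, ENNReal.ofReal (nbrSum G (fun w => Φ ((remaining A n ω).erase w) w) (ω n) /
        deg G (ω n)) ∂(walkLaw G u) := by
  have h := lintegral_walkLaw_succ G u n fun y w =>
    ENNReal.ofReal (Φ ((remaining A n (extend y)).erase w) w)
  simp only [remaining_extend] at h
  simp only [remaining_succ]
  rw [h]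
  exact lintegral_congr fun ω => lintegral_stepKernel G (hG _) _ fun w => hΦ _ _

open Classical in
/-- A superharmonic potential bounds the cover time from above. -/
theorem coverTimeFrom_le_of_potential (G : SimpleGraph V) (hG : ∀ u, 0 < deg G u)
    (Φ : Finset V → V → ℝ) (hΦ : ∀ R w, 0 ≤ Φ R w) (hΦ₀ : ∀ w, Φ ∅ w = 0)
    (hstep : ∀ R u, R.Nonempty → u ∉ R →
      deg G u + nbrSum G (fun w => Φ (R.erase w) w) u ≤ deg G u * Φ R u) (u : V) :
    coverTimeFrom G u ≤ ENNReal.ofReal (Φ (Finset.univ.erase u) u) := by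
  set E : ℕ → ℝ≥0∞ := fun n =>
    ∫⁻ ω, ENNReal.ofReal (Φ (remaining Finset.univ n ω) (ω n)) ∂(walkLaw G u)
  set p : ℕ → ℝ≥0∞ := fun n => ∫⁻ ω, pending Finset.univ n ω ∂(walkLaw G u)
  have hE₀ : E 0 = ENNReal.ofReal (Φ (Finset.univ.erase u) u) := by
    have h := lintegral_walkLaw_zero G u fun w => ENNReal.ofReal (Φ (Finset.univ.erase w) w)
    simpa only [E, remaining_zero] using h
  -- The potential loses on average at least the probability that the cover is incomplete;
  -- telescoping bounds the sum of these probabilities, with no prior knowledge that the cover time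
  -- is finite.
  have hE : ∀ n, p n + E (n + 1) ≤ E n := by
    intro n
    simp only [E, p]
    rw [lintegral_remaining_succ G hG u _ Φ hΦ, ← lintegral_add_left (measurable_pending _ n)]
    refine lintegral_mono fun ω => ?_
    have hd := hG (ω n)
    by_cases hR : (remaining Finset.univ n ω).Nonempty
    · have hs := hstep _ _ hR (notMem_remaining _ n ω)
      have h0 : 0 ≤ nbrSum G (fun w => Φ ((remaining Finset.univ n ω).erase w) w) (ω n) :=
        Finset.sum_nonneg fun w _ => by split_ifs; exacts [hΦ _ _, le_rfl]
      simp only [pending, if_pos hR]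
      rw [← ENNReal.ofReal_one, ← ENNReal.ofReal_add zero_le_one (div_nonneg h0 hd.le)]
      refine ENNReal.ofReal_le_ofReal ?_
      rw [← div_self hd.ne', ← add_div, div_le_iff₀ hd]
      linarith
    · rw [Finset.not_nonempty_iff_eq_empty] at hR
      simp [pending, hR, hΦ₀, nbrSum_const]
  have hsum : ∀ n, ∑ k ∈ Finset.range n, p k + E n ≤ E 0 := by
    intro n
    induction n with
    | zero => simp
    | succ n ih =>
      rw [Finset.sum_range_succ, add_assoc]
      exact (add_le_add_right (hE n) _).trans ih
  calc coverTimeFrom G u ≤ ∫⁻ ω, ∑' n, pending Finset.univ n ω ∂(walkLaw G u) :=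
        lintegral_mono coverStep_le_tsum_pending
    _ = ∑' n, p n := lintegral_tsum fun n => (measurable_pending _ n).aemeasurable
    _ ≤ E 0 := by
        rw [ENNReal.tsum_eq_iSup_nat]
        exact iSup_le fun n => le_self_add.trans (hsum n)
    _ = _ := hE₀

open Classical in
/-- A bounded subharmonic potential bounds the cover time from below. -/
theorem le_coverTimeFrom_of_potential (G : SimpleGraph V) (hG : ∀ u, 0 < deg G u) (A : Finset V)
    (Φ : Finset V → V → ℝ) (hΦ : ∀ R w, 0 ≤ Φ R w) (hΦ₀ : ∀ w, Φ ∅ w = 0) (K : ℝ)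
    (hK : ∀ R w, Φ R w ≤ K)
    (hstep : ∀ R u, R ⊆ A → R.Nonempty → u ∉ R →
      deg G u * Φ R u ≤ deg G u + nbrSum G (fun w => Φ (R.erase w) w) u) (u : V) :
    ENNReal.ofReal (Φ (A.erase u) u) ≤ coverTimeFrom G u := by
  set E : ℕ → ℝ≥0∞ := fun n =>
    ∫⁻ ω, ENNReal.ofReal (Φ (remaining A n ω) (ω n)) ∂(walkLaw G u)
  set p : ℕ → ℝ≥0∞ := fun n => ∫⁻ ω, pending A n ω ∂(walkLaw G u)
  have hE₀ : E 0 = ENNReal.ofReal (Φ (A.erase u) u) := by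
    have h := lintegral_walkLaw_zero G u fun w => ENNReal.ofReal (Φ (A.erase w) w)
    simpa only [E, remaining_zero] using h
  have hE : ∀ n, E n ≤ p n + E (n + 1) := by
    intro n
    simp only [E, p]
    rw [lintegral_remaining_succ G hG u _ Φ hΦ, ← lintegral_add_left (measurable_pending _ n)]
    refine lintegral_mono fun ω => ?_
    have hd := hG (ω n)
    by_cases hR : (remaining A n ω).Nonempty
    · have hs := hstep _ _ (remaining_subset A n ω) hR (notMem_remaining _ n ω)
      have h0 : 0 ≤ nbrSum G (fun w => Φ ((remaining A n ω).erase w) w) (ω n) :=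
        Finset.sum_nonneg fun w _ => by split_ifs; exacts [hΦ _ _, le_rfl]
      simp only [pending, if_pos hR]
      rw [← ENNReal.ofReal_one, ← ENNReal.ofReal_add zero_le_one (div_nonneg h0 hd.le)]
      refine ENNReal.ofReal_le_ofReal ?_
      rw [← div_self hd.ne', ← add_div, le_div_iff₀ hd]
      linarith
    · rw [Finset.not_nonempty_iff_eq_empty] at hR
      simp [hR, hΦ₀]
  have hsum : ∀ n, E 0 ≤ ∑ k ∈ Finset.range n, p k + E n := by
    intro n
    induction n with
    | zero => simp
    | succ n ih =>
      rw [Finset.sum_range_succ, add_assoc]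
      exact ih.trans (add_le_add_right (hE n) _)
  -- The lower bound must dispose of the final term `E n`. The potential vanishes once `A` is
  -- covered, so boundedness controls `E n` by `p n`, which tends to `0` unless `∑' n, p n` is
  -- infinite and there is nothing to prove.
  have hEp : ∀ n, E n ≤ ENNReal.ofReal K * p n := by
    intro n
    simp only [E, p]
    rw [← lintegral_const_mul _ (measurable_pending _ n)]
    refine lintegral_mono fun ω => ?_
    by_cases hR : (remaining A n ω).Nonempty
    · simpa only [pending, if_pos hR, mul_one] using ENNReal.ofReal_le_ofReal (hK _ _)
    · rw [Finset.not_nonempty_iff_eq_empty] at hR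
      simp [hR, hΦ₀]
  have hE₀p : E 0 ≤ ∑' n, p n := by
    by_cases htop : ∑' n, p n = ∞
    · simp [htop]
    · have hlim : Filter.Tendsto (fun n => ∑' k, p k + ENNReal.ofReal K * p n) Filter.atTop
          (nhds (∑' k, p k + ENNReal.ofReal K * 0)) :=
        (ENNReal.Tendsto.const_mul (ENNReal.tendsto_atTop_zero_of_tsum_ne_top htop)
          (Or.inr ENNReal.ofReal_ne_top)).const_add _
      rw [mul_zero, add_zero] at hlim
      exact ge_of_tendsto' hlim fun n =>
        (hsum n).trans (add_le_add (ENNReal.sum_le_tsum _) (hEp n))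
  calc ENNReal.ofReal (Φ (A.erase u) u) = E 0 := hE₀.symm
    _ ≤ ∑' n, p n := hE₀p
    _ = ∫⁻ ω, ∑' n, pending A n ω ∂(walkLaw G u) :=
        (lintegral_tsum fun n => (measurable_pending _ n).aemeasurable).symm
    _ ≤ coverTimeFrom G u := lintegral_mono (tsum_pending_le_coverStep A)

end Potential

end RandomWalk

namespace RandomWalk

/-! ### Matthews' bounds through a harmonic potential. -/

section Matthews

variable {V : Type*}

/-- Matthews' potential: the average over the unvisited nodes `b` of the hitting times `f b`,
corrected by a harmonic sum that accounts for the later visits. -/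
noncomputable def matthews (f : V → V → ℝ) (M : ℝ) (R : Finset V) (u : V) : ℝ :=
  open Classical in
  if R = ∅ then 0 else (∑ b ∈ R, f b u) / R.card + M * ((harmonic R.card : ℝ) - 1)

theorem one_le_harmonic {n : ℕ} (hn : n ≠ 0) : (1 : ℝ) ≤ harmonic n := by
  have h : (1 : ℚ) ≤ harmonic n := by
    rw [harmonic]
    calc (1 : ℚ) = ∑ i ∈ Finset.range 1, ((i + 1 : ℕ) : ℚ)⁻¹ := by simp
      _ ≤ _ := Finset.sum_le_sum_of_subset_of_nonneg
        (Finset.range_mono (Nat.one_le_iff_ne_zero.2 hn)) fun _ _ _ => by positivity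
  exact_mod_cast h

theorem matthews_nonneg {f : V → V → ℝ} {M : ℝ} (hf : ∀ b u, 0 ≤ f b u) (hM : 0 ≤ M)
    (R : Finset V) (u : V) : 0 ≤ matthews f M R u := by
  unfold matthews
  split_ifs with h
  · exact le_rfl
  · have h1 := one_le_harmonic (n := R.card) (by simpa using h)
    have h2 : 0 ≤ ∑ b ∈ R, f b u := Finset.sum_nonneg fun b _ => hf b u
    exact add_nonneg (by positivity) (mul_nonneg hM (by linarith))

open Classical in
/-- The change of Matthews' potential when the unvisited node `w` is visited. -/
theorem matthews_erase_sub {f : V → V → ℝ} {M : ℝ} {R : Finset V} {w : V} (hw : w ∈ R)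
    (hfw : f w w = 0) :
    matthews f M (R.erase w) w -
        ((∑ b ∈ R, f b w) / R.card + M * ((harmonic R.card : ℝ) - 1)) =
      (∑ b ∈ R.erase w, (f b w - M)) / (((R.card : ℝ) - 1) * R.card) := by
  have hsum : ∑ b ∈ R, f b w = ∑ b ∈ R.erase w, f b w := by
    rw [← Finset.add_sum_erase R _ hw, hfw, zero_add]
  obtain ⟨r, hr⟩ : ∃ r, R.card = r + 1 :=
    Nat.exists_eq_succ_of_ne_zero (Finset.card_ne_zero_of_mem hw)
  have hr' : (R.erase w).card = r := by rw [Finset.card_erase_of_mem hw, hr]; simp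
  have hH : ((harmonic (r + 1) : ℚ) : ℝ) = harmonic r + ((r : ℝ) + 1)⁻¹ := by
    rw [harmonic_succ]; push_cast; rfl
  rw [hsum, Finset.sum_sub_distrib, Finset.sum_const, hr', hr, nsmul_eq_mul]
  -- If `w` is the last unvisited node, the denominator on the right is `0`, and both sides are `0`
  -- by the convention on division.
  rcases Nat.eq_zero_or_pos r with h0 | hpos
  · subst h0
    rw [Finset.card_eq_zero] at hr'
    simp [matthews, hr', harmonic]
  · have hne : R.erase w ≠ ∅ := by
      rintro h
      rw [h, Finset.card_empty] at hr'
      omega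
    rw [matthews, if_neg hne, hr', hH]
    have : (0 : ℝ) < r := by exact_mod_cast hpos
    push_cast
    rw [add_sub_cancel_right]
    field_simp
    ring

variable [Fintype V]

theorem nbrSum_average (G : SimpleGraph V) (f : V → V → ℝ) (R : Finset V) (c : ℝ) (u : V) :
    nbrSum G (fun w => (∑ b ∈ R, f b w) / R.card + c) u =
      (∑ b ∈ R, nbrSum G (f b) u) / R.card + c * deg G u := by
  simp only [div_eq_inv_mul]
  rw [nbrSum_add, nbrSum_const_mul, nbrSum_sum, nbrSum_const]

variable [MeasurableSpace V] [DiscreteMeasurableSpace V]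

/-- Matthews' upper bound. -/
theorem coverTimeFrom_le_mul_harmonic (G : SimpleGraph V) (hG : ∀ u, 0 < deg G u)
    (f : V → V → ℝ) (M : ℝ) (hf : ∀ b u, 0 ≤ f b u) (hf₀ : ∀ b, f b b = 0)
    (hfM : ∀ b u, f b u ≤ M)
    (hstep : ∀ b u, u ≠ b → deg G u + nbrSum G (f b) u ≤ deg G u * f b u) (u : V) :
    coverTimeFrom G u ≤ ENNReal.ofReal (M * harmonic (Fintype.card V)) := by
  classical
  have hM : 0 ≤ M := (hf u u).trans (hfM u u)
  refine (coverTimeFrom_le_of_potential G hG (matthews f M) (matthews_nonneg hf hM)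
    (fun w => if_pos rfl) (fun R u hR hu => ?_) u).trans (ENNReal.ofReal_le_ofReal ?_)
  · have hr : (0 : ℝ) < R.card := by exact_mod_cast hR.card_pos
    -- Freezing `R` can only raise the potential, since by `matthews_erase_sub` the correction on
    -- visiting a node has the sign of `f b w - M`. With `R` frozen, the mean of the hitting-time
    -- bounds decreases by at least one per step.
    have h1 : nbrSum G (fun w => matthews f M (R.erase w) w) u ≤
        nbrSum G (fun w => (∑ b ∈ R, f b w) / R.card + M * ((harmonic R.card : ℝ) - 1)) u := by
      refine nbrSum_mono G u fun w _ => ?_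
      by_cases hw : w ∈ R
      · rw [← sub_nonpos, matthews_erase_sub hw (hf₀ w)]
        refine div_nonpos_of_nonpos_of_nonneg
          (Finset.sum_nonpos fun b _ => sub_nonpos.2 (hfM b w)) (mul_nonneg ?_ hr.le)
        rw [sub_nonneg]
        exact_mod_cast hR.card_pos
      · rw [Finset.erase_eq_of_notMem hw, matthews, if_neg hR.ne_empty]
    rw [nbrSum_average] at h1
    have h2 : ∑ b ∈ R, (deg G u + nbrSum G (f b) u) ≤ ∑ b ∈ R, deg G u * f b u :=
      Finset.sum_le_sum fun b hb => hstep b u fun h => hu (h ▸ hb)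
    rw [Finset.sum_add_distrib, Finset.sum_const, nsmul_eq_mul, ← Finset.mul_sum] at h2
    rw [matthews, if_neg hR.ne_empty, mul_add]
    have h3 : deg G u + (∑ b ∈ R, nbrSum G (f b) u) / R.card ≤
        deg G u * ((∑ b ∈ R, f b u) / R.card) := by
      rw [← mul_div_assoc, le_div_iff₀ hr, add_mul, div_mul_cancel₀ _ hr.ne']
      linarith
    linarith
  · have hmono : ((harmonic (Finset.univ.erase u).card : ℚ) : ℝ) ≤ harmonic (Fintype.card V) := by
      rw [harmonic, harmonic]
      exact_mod_cast Finset.sum_le_sum_of_subset_of_nonneg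
        (Finset.range_mono (Finset.card_le_univ _)) fun _ _ _ => by positivity
    unfold matthews
    split_ifs with h
    · have : Nonempty V := ⟨u⟩
      exact mul_nonneg hM (zero_le_one.trans (one_le_harmonic Fintype.card_ne_zero))
    · have hr : (0 : ℝ) < (Finset.univ.erase u).card := by
        exact_mod_cast (Finset.nonempty_iff_ne_empty.2 h).card_pos
      have h1 : (∑ b ∈ Finset.univ.erase u, f b u) / (Finset.univ.erase u).card ≤ M := by
        rw [div_le_iff₀ hr]
        calc _ ≤ ∑ b ∈ Finset.univ.erase u, M := Finset.sum_le_sum fun b _ => hfM b u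
          _ = _ := by rw [Finset.sum_const, nsmul_eq_mul, mul_comm]
      have h2 := mul_le_mul_of_nonneg_left hmono hM
      linarith

/-- Matthews' lower bound. -/
theorem mul_harmonic_le_coverTimeFrom (G : SimpleGraph V) (hG : ∀ u, 0 < deg G u)
    (f : V → V → ℝ) (A : Finset V) (hA : A.Nonempty) (h : ℝ) (hh : 0 ≤ h)
    (hf : ∀ b u, 0 ≤ f b u) (hf₀ : ∀ b, f b b = 0)
    (hfh : ∀ b ∈ A, ∀ a, a ≠ b → h ≤ f b a)
    (hstep : ∀ b u, u ≠ b → deg G u * f b u ≤ deg G u + nbrSum G (f b) u) (u : V) (hu : u ∉ A) :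
    ENNReal.ofReal (h * harmonic A.card) ≤ coverTimeFrom G u := by
  classical
  obtain ⟨K, hK⟩ := (Set.finite_range fun p : Finset V × V => matthews f h p.1 p.2).bddAbove
  refine le_trans (ENNReal.ofReal_le_ofReal ?_) (le_coverTimeFrom_of_potential G hG A
    (matthews f h) (matthews_nonneg hf hh) (fun w => if_pos rfl) K
    (fun R w => hK ⟨(R, w), rfl⟩) (fun R u hRA hR hu => ?_) u)
  · have hr : (0 : ℝ) < A.card := by exact_mod_cast hA.card_pos
    -- Starting outside `A` keeps all of `A` unvisited at time `0`, so the whole harmonic number of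
    -- `A.card` is gained.
    rw [Finset.erase_eq_of_notMem hu, matthews, if_neg hA.ne_empty]
    have h1 : h ≤ (∑ b ∈ A, f b u) / A.card := by
      rw [le_div_iff₀ hr]
      calc h * A.card = ∑ b ∈ A, h := by rw [Finset.sum_const, nsmul_eq_mul, mul_comm]
        _ ≤ _ := Finset.sum_le_sum fun b hb => hfh b hb u fun e => hu (e ▸ hb)
    linarith
  · have hr : (0 : ℝ) < R.card := by exact_mod_cast hR.card_pos
    have h1 : nbrSum G (fun w => (∑ b ∈ R, f b w) / R.card + h * ((harmonic R.card : ℝ) - 1)) u ≤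
        nbrSum G (fun w => matthews f h (R.erase w) w) u := by
      refine nbrSum_mono G u fun w _ => ?_
      by_cases hw : w ∈ R
      · rw [← sub_nonneg, matthews_erase_sub hw (hf₀ w)]
        refine div_nonneg (Finset.sum_nonneg fun b hb => sub_nonneg.2 ?_) (mul_nonneg ?_ hr.le)
        · exact hfh b (hRA (Finset.mem_of_mem_erase hb)) w (Finset.ne_of_mem_erase hb).symm
        · rw [sub_nonneg]
          exact_mod_cast hR.card_pos
      · rw [Finset.erase_eq_of_notMem hw, matthews, if_neg hR.ne_empty]
    rw [nbrSum_average] at h1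
    have h2 : ∑ b ∈ R, deg G u * f b u ≤ ∑ b ∈ R, (deg G u + nbrSum G (f b) u) :=
      Finset.sum_le_sum fun b hb => hstep b u fun h => hu (h ▸ hb)
    rw [Finset.sum_add_distrib, Finset.sum_const, nsmul_eq_mul, ← Finset.mul_sum] at h2
    rw [matthews, if_neg hR.ne_empty, mul_add]
    have h3 : deg G u * ((∑ b ∈ R, f b u) / R.card) ≤
        deg G u + (∑ b ∈ R, nbrSum G (f b) u) / R.card := by
      rw [← mul_div_assoc, div_le_iff₀ hr, add_mul, div_mul_cancel₀ _ hr.ne']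
      linarith
    linarith

end Matthews

/-! ### Hitting times as solutions of linear equations. -/

section Hitting

variable {V : Type*} [Fintype V]

open Classical in
theorem nbrSum_ite_eq (G : SimpleGraph V) (a : V) (c : ℝ) (u : V) :
    nbrSum G (fun w => if w = a then c else 0) u = if G.Adj u a then c else 0 := by
  rw [nbrSum, Finset.sum_eq_single a]
  · simp
  · intro w _ hw
    simp [hw]
  · simp

theorem sum_nbrSum (G : SimpleGraph V) (f : V → ℝ) :
    ∑ u, nbrSum G f u = ∑ u, deg G u * f u := by
  classical
  simp only [deg, nbrSum, Finset.sum_mul]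
  rw [Finset.sum_comm]
  refine Finset.sum_congr rfl fun w _ => Finset.sum_congr rfl fun u _ => ?_
  simp only [ite_mul, one_mul, zero_mul]
  exact if_congr (G.adj_comm u w) rfl rfl

/-- `f` is the vector of the expected hitting times of `b`, given by first-step analysis. -/
structure IsHittingTime (G : SimpleGraph V) (b : V) (f : V → ℝ) : Prop where
  target : f b = 0
  nonneg : ∀ u, 0 ≤ f u
  step : ∀ u, u ≠ b → deg G u * f u = deg G u + nbrSum G f u

/-- The Laplacian plus evaluation at `b` is invertible: its output sums to `f b`, so a kernel
element vanishes at `b`, is then harmonic, hence constant by connectedness. The right-hand side has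
total `0`, which forces `f b = 0`. Nonnegativity is the minimum principle. -/
theorem exists_isHittingTime (G : SimpleGraph V) (hc : G.Connected) (hG : ∀ u, 0 < deg G u)
    (b : V) : ∃ f, IsHittingTime G b f := by
  classical
  let L : (V → ℝ) →ₗ[ℝ] (V → ℝ) := Matrix.toLin' (G.lapMatrix ℝ) +
    (LinearMap.single ℝ (fun _ : V => ℝ) b).comp (LinearMap.proj b)
  have hlap : ∀ f u, (Matrix.mulVec (G.lapMatrix ℝ) f) u = deg G u * f u - nbrSum G f u := by
    intro f u
    rw [SimpleGraph.lapMatrix_mulVec_apply, nbrSum_eq_sum_neighborFinset, deg_eq_card]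
    congr!
  have hL : ∀ f, L f = Matrix.mulVec (G.lapMatrix ℝ) f + Pi.single b (f b) := fun f => rfl
  have hsum : ∀ f, ∑ u, L f u = f b := by
    intro f
    simp only [hL, Pi.add_apply, Finset.sum_add_distrib, hlap, Finset.sum_sub_distrib, sum_nbrSum]
    simp
  have hinj : Function.Injective L := by
    rw [injective_iff_map_eq_zero]
    intro f hf
    have hb : f b = 0 := by rw [← hsum f, hf]; simp
    have h0 : Matrix.mulVec (G.lapMatrix ℝ) f = 0 := by
      rw [← hf, hL, hb, Pi.single_zero, add_zero]
    rw [SimpleGraph.lapMatrix_mulVec_eq_zero_iff_forall_reachable] at h0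
    ext u
    rw [h0 u b (hc.preconnected u b), hb, Pi.zero_apply]
  obtain ⟨f, hf⟩ := LinearMap.injective_iff_surjective.1 hinj
    (deg G - Pi.single b (∑ u, deg G u))
  have hb : f b = 0 := by rw [← hsum f, hf]; simp
  have hstep : ∀ u, u ≠ b → deg G u * f u = deg G u + nbrSum G f u := by
    intro u hu
    have h := congrFun hf u
    rw [hL, hb, Pi.single_zero, add_zero, hlap, Pi.sub_apply, Pi.single_eq_of_ne hu] at h
    linarith
  refine ⟨f, hb, fun u => ?_, hstep⟩
  have : Nonempty V := ⟨b⟩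
  obtain ⟨m, hm⟩ := Finite.exists_min f
  by_cases hmb : m = b
  · rw [← hb, ← hmb]; exact hm u
  · have h1 := hstep m hmb
    have h2 := nbrSum_mono G m (f := fun _ => f m) (f' := f) fun w _ => hm w
    rw [nbrSum_const] at h2
    linarith [hG m]

namespace IsHittingTime

variable {G : SimpleGraph V} {b : V} {f : V → ℝ}

theorem one_le (hG : ∀ u, 0 < deg G u) (hf : IsHittingTime G b f) {u : V} (hu : u ≠ b) :
    1 ≤ f u := by
  have h := nbrSum_mono G u (f := fun _ => 0) (f' := f) fun w _ => hf.nonneg w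
  rw [nbrSum_const, zero_mul] at h
  have h1 := hf.step u hu
  exact le_of_mul_le_mul_left (by linarith) (hG u)

/-- This is Kac's return-time formula (mean return time equals total degree over `deg G b`),
obtained by summing the first-step equations over all nodes. -/
theorem nbrSum_target (hf : IsHittingTime G b f) : nbrSum G f b = ∑ u, deg G u - deg G b := by
  classical
  have h := sum_nbrSum G f
  rw [← Finset.add_sum_erase _ _ (Finset.mem_univ b),
    ← Finset.add_sum_erase _ (fun u => deg G u * f u) (Finset.mem_univ b), hf.target, mul_zero,
    zero_add, Finset.sum_congr rfl fun u hu => hf.step u (Finset.ne_of_mem_erase hu),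
    Finset.sum_add_distrib] at h
  rw [← Finset.add_sum_erase _ (deg G) (Finset.mem_univ b)]
  linarith

/-- Off the target, the hitting time is smallest at a neighbour of the target. -/
theorem exists_adj_forall_le (hG : ∀ u, 0 < deg G u) (hf : IsHittingTime G b f) :
    ∃ m, G.Adj b m ∧ ∀ u, u ≠ b → f m ≤ f u := by
  classical
  obtain ⟨c, hc⟩ : (G.neighborFinset b).Nonempty := by
    have h := hG b
    rw [deg_eq_card] at h
    exact Finset.card_pos.1 (by exact_mod_cast h)
  rw [SimpleGraph.mem_neighborFinset] at hc
  obtain ⟨m, hm, hmin⟩ := Finset.exists_min_image (Finset.univ.erase b) f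
    ⟨c, by simp [hc.ne']⟩
  have hmin' : ∀ u, u ≠ b → f m ≤ f u := fun u hu => hmin u (by simp [hu])
  have hmb : m ≠ b := Finset.ne_of_mem_erase hm
  refine ⟨m, ?_, hmin'⟩
  by_contra hadj
  have h1 := hf.step m hmb
  have h2 := nbrSum_mono G m (f := fun _ => f m) (f' := f) fun w hw =>
    hmin' w fun h => hadj (h ▸ hw.symm)
  rw [nbrSum_const] at h2
  linarith [hG m]

end IsHittingTime

/-- `f` is a bounded supersolution of the equations for the expected hitting times of `b`. -/
structure IsHittingBound (G : SimpleGraph V) (b : V) (M : ℝ) (f : V → ℝ) : Prop where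
  target : f b = 0
  nonneg : ∀ u, 0 ≤ f u
  le : ∀ u, f u ≤ M
  step : ∀ u, u ≠ b → deg G u + nbrSum G f u ≤ deg G u * f u

theorem IsHittingBound.mono {G : SimpleGraph V} {b : V} {M M' : ℝ} {f : V → ℝ}
    (hf : IsHittingBound G b M f) (h : M ≤ M') : IsHittingBound G b M' f :=
  ⟨hf.target, hf.nonneg, fun u => (hf.le u).trans h, hf.step⟩

/-- Hitting `b` by way of `a`. -/
theorem IsHittingTime.isHittingBound_min {G : SimpleGraph V} (hG : ∀ u, 0 < deg G u) {a b : V}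
    {M : ℝ} {f h : V → ℝ} (hf : IsHittingTime G b f) (hh : IsHittingBound G a M h) :
    IsHittingBound G b (f a + M) fun u => min (f u) (f a + h u) where
  target := by
    rw [hf.target]
    exact min_eq_left (add_nonneg (hf.nonneg a) (hh.nonneg b))
  nonneg u := le_min (hf.nonneg u) (add_nonneg (hf.nonneg a) (hh.nonneg u))
  le u := (min_le_right _ _).trans (by linarith [hh.le u])
  step u hu := by
    have h1 := nbrSum_mono G u (f := fun u => min (f u) (f a + h u)) (f' := f)
      fun w _ => min_le_left _ _
    have h2 := nbrSum_mono G u (f := fun u => min (f u) (f a + h u)) (f' := fun w => f a + h w)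
      fun w _ => min_le_right _ _
    rw [nbrSum_add, nbrSum_const] at h2
    have h3 := hf.step u hu
    rw [mul_min_of_nonneg _ _ (hG u).le]
    refine le_min (by linarith) ?_
    -- A minimum of supersolutions is a supersolution. At `a` the second one need not be, but there
    -- it equals `f a`, so the equation for `f` takes over.
    by_cases hua : u = a
    · subst hua
      rw [hh.target, add_zero]
      linarith
    · linarith [hh.step u hua]

end Hitting

end RandomWalk

namespace Apollonian

/-! ### Combinatorics of the networks: degrees and triangles. -/

open RandomWalk

/-- A node of the previous iteration. -/
def old {g : ℕ} (u : Node g) : Node (g + 1) := Sum.inl u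

/-- The node placed in a triangle of the previous iteration. -/
def new {g : ℕ} (t : Tri g) : Node (g + 1) := Sum.inr t

theorem node_cases {g : ℕ} {p : Node (g + 1) → Prop} (ho : ∀ u, p (old u)) (hn : ∀ t, p (new t))
    (x : Node (g + 1)) : p x :=
  Sum.casesOn x ho hn

theorem old_injective {g : ℕ} : Function.Injective (old (g := g)) := Sum.inl_injective

theorem new_injective {g : ℕ} : Function.Injective (new (g := g)) := Sum.inr_injective

theorem old_ne_new {g : ℕ} (u : Node g) (t : Tri g) : old u ≠ new t := Sum.inl_ne_inr

theorem sum_node_succ {g : ℕ} {α : Type*} [AddCommMonoid α] (F : Node (g + 1) → α) :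
    ∑ x, F x = ∑ u, F (old u) + ∑ t, F (new t) :=
  Fintype.sum_sum_type F

theorem sum_tri_succ {g : ℕ} {α : Type*} [AddCommMonoid α] (F : Tri (g + 1) → α) :
    ∑ s, F s = ∑ t : Tri g, ∑ k : Fin 3, F (t, k) :=
  Fintype.sum_prod_type F

theorem corner_succ {g : ℕ} (t : Tri g) (k j : Fin 3) :
    corner (g + 1) (t, k) j = if j = k then new t else old (corner g t j) := rfl

theorem corner_injective : (g : ℕ) → ∀ t : Tri g, Function.Injective (corner g t)
  | 0 => fun t => Fin.succAbove_right_injective (n := 3) (p := t)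
  | g + 1 => fun t i j h => by
    obtain ⟨t, k⟩ := t
    rw [corner_succ, corner_succ] at h
    split_ifs at h with hi hj hj
    · rw [hi, hj]
    · exact absurd h.symm (old_ne_new _ _)
    · exact absurd h (old_ne_new _ _)
    · exact corner_injective g t (old_injective h)

theorem card_tri (g : ℕ) : Fintype.card (Tri g) = 4 * 3 ^ g := by
  induction g with
  | zero => rfl
  | succ g ih =>
    rw [show Fintype.card (Tri (g + 1)) = Fintype.card (Tri g) * 3 from Fintype.card_prod _ _, ih]
    ring

theorem card_node (g : ℕ) : Fintype.card (Node g) = 2 * 3 ^ g + 2 := by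
  induction g with
  | zero => rfl
  | succ g ih =>
    rw [show Fintype.card (Node (g + 1)) = Fintype.card (Node g) + Fintype.card (Tri g) from
      Fintype.card_sum, ih, card_tri]
    ring

theorem adj_new_old {g : ℕ} {t : Tri g} {u : Node g} :
    (network (g + 1)).Adj (new t) (old u) ↔ ∃ j, corner g t j = u := Iff.rfl

theorem network_connected (g : ℕ) : (network g).Connected := by
  induction g with
  | zero =>
    have : Nonempty (Node 0) := ⟨(0 : Fin 4)⟩
    refine ⟨fun u v => ?_⟩
    by_cases h : u = v
    · rw [h]
    · exact SimpleGraph.Adj.reachable h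
  | succ g ih =>
    have hold : ∀ u v, (network (g + 1)).Reachable (old u) (old v) := fun u v =>
      (ih.preconnected u v).map ⟨old, fun h => h⟩
    obtain ⟨u₀⟩ := ih.nonempty
    have h : ∀ x, (network (g + 1)).Reachable x (old u₀) := by
      refine node_cases (fun u => hold u u₀) fun t => ?_
      exact (SimpleGraph.Adj.reachable (adj_new_old.2 ⟨0, rfl⟩)).trans (hold (corner g t 0) u₀)
    have : Nonempty (Node (g + 1)) := ⟨old u₀⟩
    exact ⟨fun x y => (h x).trans (h y).symm⟩

open Classical in
/-- The sum of `ψ` over the triangles generated at iteration `g` that contain `u`. -/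
noncomputable def triSum (g : ℕ) (ψ : Tri g → ℝ) (u : Node g) : ℝ :=
  ∑ t, ∑ i, if corner g t i = u then ψ t else 0

theorem triSum_add (g : ℕ) (ψ ψ' : Tri g → ℝ) (u : Node g) :
    triSum g (fun t => ψ t + ψ' t) u = triSum g ψ u + triSum g ψ' u := by
  simp only [triSum, ← Finset.sum_add_distrib]
  exact Finset.sum_congr rfl fun t _ => Finset.sum_congr rfl fun i _ => by split_ifs <;> simp

theorem triSum_const_mul (g : ℕ) (c : ℝ) (ψ : Tri g → ℝ) (u : Node g) :
    triSum g (fun t => c * ψ t) u = c * triSum g ψ u := by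
  simp only [triSum, Finset.mul_sum, mul_ite, mul_zero]

theorem nbrSum_old {g : ℕ} (F : Node (g + 1) → ℝ) (u : Node g) :
    nbrSum (network (g + 1)) F (old u) =
      nbrSum (network g) (fun w => F (old w)) u + triSum g (fun t => F (new t)) u := by
  classical
  simp only [nbrSum, triSum]
  rw [sum_node_succ]
  congr 1
  refine Finset.sum_congr rfl fun t _ => ?_
  rw [if_congr ((network (g + 1)).adj_comm (old u) (new t) |>.trans adj_new_old) rfl rfl]
  by_cases h : ∃ j, corner g t j = u
  · obtain ⟨j, rfl⟩ := h
    rw [if_pos ⟨j, rfl⟩]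
    simp [(corner_injective g t).eq_iff]
  · rw [if_neg h]
    push Not at h
    simp [h]

theorem nbrSum_new {g : ℕ} (F : Node (g + 1) → ℝ) (t : Tri g) :
    nbrSum (network (g + 1)) F (new t) = ∑ j, F (old (corner g t j)) := by
  classical
  have h0 : ∀ s : Tri g, ¬ (network (g + 1)).Adj (new t) (new s) := fun s h => h
  simp only [nbrSum, sum_node_succ, h0, if_false, Finset.sum_const_zero, add_zero, adj_new_old]
  rw [← Finset.sum_filter]
  have himg : Finset.univ.filter (fun u => ∃ j, corner g t j = u) =
      Finset.univ.image (corner g t) := by ext; simp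
  rw [himg, Finset.sum_image (corner_injective g t).injOn]

theorem deg_new {g : ℕ} (t : Tri g) : deg (network (g + 1)) (new t) = 3 := by
  simp [deg, nbrSum_new]

/-- The triangle identity is assumed rather than cited because the degree count is needed inside the
induction that proves it in `triSum_corner`. -/
theorem triSum_one_of_triSum_corner {g : ℕ}
    (h : ∀ (φ : Node g → ℝ) (u : Node g), triSum g (fun t => ∑ j, φ (corner g t j)) u =
      deg (network g) u * φ u + 2 * nbrSum (network g) φ u) (u : Node g) :
    triSum g (fun _ => 1) u = deg (network g) u := by
  have h1 := h (fun _ => 1) u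
  rw [nbrSum_const] at h1
  have h2 : triSum g (fun _ => ∑ _ : Fin 3, (1 : ℝ)) u = 3 * triSum g (fun _ => 1) u := by
    rw [← triSum_const_mul]; simp
  linarith

theorem deg_old_of_triSum_one {g : ℕ} {u : Node g}
    (h : triSum g (fun _ => 1) u = deg (network g) u) :
    deg (network (g + 1)) (old u) = 2 * deg (network g) u := by
  rw [deg, nbrSum_old, h, ← deg]
  ring

theorem nbrSum_zero (F : Node 0 → ℝ) (u : Node 0) :
    nbrSum (network 0) F u = ∑ x, F x - F u := by
  classical
  have h : ∀ w, (network 0).Adj u w ↔ w ∈ Finset.univ.erase u := fun w => by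
    rw [Finset.mem_erase, and_iff_left (Finset.mem_univ w)]
    exact ne_comm
  simp only [nbrSum, h]
  rw [Finset.sum_ite_mem, Finset.univ_inter, Finset.sum_erase_eq_sub (Finset.mem_univ u)]

theorem deg_zero (u : Node 0) : deg (network 0) u = 3 := by
  rw [deg, nbrSum_zero, Finset.sum_const, Finset.card_univ, card_node]
  norm_num

theorem sum_corner_zero (F : Node 0 → ℝ) (t : Fin 4) :
    ∑ j, F (corner 0 t j) = ∑ x, F x - F t :=
  eq_sub_of_add_eq' (Fin.sum_univ_succAbove (n := 3) (F : Fin 4 → ℝ) t).symm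

/-- Every node lies in as many triangles as it has neighbours, every edge in two triangles. -/
theorem triSum_corner (g : ℕ) (φ : Node g → ℝ) (u : Node g) :
    triSum g (fun t => ∑ j, φ (corner g t j)) u =
      deg (network g) u * φ u + 2 * nbrSum (network g) φ u := by
  classical
  induction g with
  | zero =>
    have h : ∀ ψ : Fin 4 → ℝ,
        (∑ t : Fin 4, ∑ i, if corner 0 t i = u then ψ t else 0) = ∑ t, ψ t - ψ u := by
      intro ψ
      have h1 : ∀ t : Fin 4, (∑ i, if corner 0 t i = u then ψ t else 0) =
          ψ t - if t = u then ψ t else 0 := by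
        intro t
        rw [sum_corner_zero (fun x => if x = u then ψ t else 0) t, Finset.sum_ite_eq',
          if_pos (Finset.mem_univ u)]
        rfl
      rw [Finset.sum_congr rfl fun t _ => h1 t, Finset.sum_sub_distrib]
      congr 1
      exact (Finset.sum_ite_eq' Finset.univ u ψ).trans (if_pos (Finset.mem_univ _))
    have h2 : ∑ t : Fin 4, ∑ j, φ (corner 0 t j) = 4 * ∑ x, φ x - ∑ x, φ x := by
      rw [Finset.sum_congr rfl fun t _ => sum_corner_zero φ t]
      refine (Finset.sum_sub_distrib (fun _ : Fin 4 => ∑ x, φ x) (φ : Fin 4 → ℝ)).trans ?_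
      rw [Finset.sum_const, Finset.card_univ, Fintype.card_fin, nsmul_eq_mul]
      rfl
    refine (h fun t => ∑ j, φ (corner 0 t j)).trans ?_
    rw [h2, deg_zero, nbrSum_zero, sum_corner_zero φ u]
    ring
  | succ g ih =>
    have hcount := triSum_one_of_triSum_corner ih
    revert u
    refine node_cases (fun u => ?_) fun s => ?_
    -- Of the three triangles born from `t`, two contain its corner `u`. Together they contain the
    -- new node twice, `u` twice, and each other corner of `t` once.
    · have h1 : triSum (g + 1) (fun t => ∑ j, φ (corner (g + 1) t j)) (old u) =
          triSum g (fun t => (2 * φ (new t) + ∑ j, φ (old (corner g t j))) + φ (old u) * 1) u := by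
        simp only [triSum]
        rw [sum_tri_succ]
        refine Finset.sum_congr rfl fun t _ => ?_
        rw [Finset.sum_comm]
        refine Finset.sum_congr rfl fun i _ => ?_
        by_cases hi : corner g t i = u
        · subst hi
          fin_cases i <;>
            simp [Fin.sum_univ_succ, corner_succ, (old_ne_new _ _).symm] <;> ring
        · rw [if_neg hi]
          refine Finset.sum_eq_zero fun k _ => if_neg ?_
          rw [corner_succ]
          split_ifs
          · exact (old_ne_new _ _).symm
          · exact fun h => hi (old_injective h)
      rw [h1, triSum_add, triSum_add, triSum_const_mul, triSum_const_mul,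
        ih (fun w => φ (old w)) u, hcount, nbrSum_old, deg_old_of_triSum_one (hcount u)]
      ring
    · have h1 : triSum (g + 1) (fun t => ∑ j, φ (corner (g + 1) t j)) (new s) =
          3 * φ (new s) + 2 * ∑ j, φ (old (corner g s j)) := by
        simp only [triSum]
        rw [sum_tri_succ, Finset.sum_eq_single s]
        · simp [Fin.sum_univ_succ, corner_succ, old_ne_new]
          ring
        · intro t _ hts
          refine Finset.sum_eq_zero fun k _ => Finset.sum_eq_zero fun i _ => if_neg ?_
          rw [corner_succ]
          split_ifs
          · exact fun h => hts (new_injective h)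
          · exact old_ne_new _ _
        · simp
      rw [h1, deg_new, nbrSum_new]

theorem triSum_one (g : ℕ) (u : Node g) : triSum g (fun _ => 1) u = deg (network g) u :=
  triSum_one_of_triSum_corner (triSum_corner g) u

theorem deg_old {g : ℕ} (u : Node g) :
    deg (network (g + 1)) (old u) = 2 * deg (network g) u :=
  deg_old_of_triSum_one (triSum_one g u)

theorem deg_pos (g : ℕ) (u : Node g) : 0 < deg (network g) u := by
  induction g with
  | zero => rw [deg_zero]; norm_num
  | succ g ih =>
    revert u
    refine node_cases (fun u => ?_) fun t => ?_
    · rw [deg_old]; linarith [ih u]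
    · rw [deg_new]; norm_num

theorem sum_deg (g : ℕ) : ∑ u, deg (network g) u = 12 * 3 ^ g := by
  induction g with
  | zero =>
    have h : Fintype.card (Node 0) = 4 := rfl
    simp only [deg_zero, Finset.sum_const, Finset.card_univ, h]
    norm_num
  | succ g ih =>
    simp only [sum_node_succ, deg_old, deg_new, ← Finset.mul_sum, ih, Finset.sum_const,
      Finset.card_univ, card_tri]
    norm_num
    ring

/-! ### Hitting times are at most of order `3 ^ g`. -/

/-- A bound for hitting an old node is inherited with the time scale `9 / 5`. -/
theorem isHittingBound_old {g : ℕ} {v : Node g} {M : ℝ} {f : Node g → ℝ}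
    (hf : IsHittingBound (network g) v M f) :
    ∃ F, IsHittingBound (network (g + 1)) (old v) (1 + 9 / 5 * M) F := by
  -- The values at new nodes solve the first-step equation exactly. With scale `s` on old nodes, the
  -- inequality at an old node has coefficient `5 * s / 3` on `f` against `3` on the degree, so `s =
  -- 9 / 5` makes it three times the old inequality.
  let F : Node (g + 1) → ℝ := fun x => Sum.elim (fun u => 9 / 5 * f u)
    (fun t => 1 + 3 / 5 * ∑ j, f (corner g t j)) x
  have hFo : ∀ u, F (old u) = 9 / 5 * f u := fun u => rfl
  have hFn : ∀ t, F (new t) = 1 + 3 / 5 * ∑ j, f (corner g t j) := fun t => rfl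
  refine ⟨F, ?_, node_cases ?_ ?_, node_cases ?_ ?_, node_cases ?_ ?_⟩
  · rw [hFo, hf.target, mul_zero]
  · intro u
    rw [hFo]
    linarith [hf.nonneg u]
  · intro t
    rw [hFn]
    linarith [Finset.sum_nonneg fun j (_ : j ∈ Finset.univ) => hf.nonneg (corner g t j)]
  · intro u
    rw [hFo]
    linarith [hf.le u]
  · intro t
    rw [hFn, Fin.sum_univ_three]
    linarith [hf.le (corner g t 0), hf.le (corner g t 1), hf.le (corner g t 2)]
  · intro u hu
    have hs := hf.step u fun h => hu (h ▸ rfl)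
    simp only [nbrSum_old, deg_old, hFo, hFn]
    rw [nbrSum_const_mul, triSum_add, triSum_const_mul, triSum_corner, triSum_one]
    linarith
  · intro t _
    simp only [nbrSum_new, deg_new, hFo, hFn, ← Finset.mul_sum]
    linarith

theorem exists_isHittingTime_network (g : ℕ) (b : Node g) : ∃ f, IsHittingTime (network g) b f :=
  exists_isHittingTime _ (network_connected g) (deg_pos g) b

/-- All expected hitting times are of the order of the number of nodes at most. -/
theorem exists_isHittingBound (g : ℕ) (v : Node g) :
    ∃ f, IsHittingBound (network g) v (31 * 3 ^ g) f := by
  classical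
  induction g with
  | zero =>
    refine ⟨fun w => if w = v then 0 else 3, if_pos rfl, fun u => ?_, fun u => ?_, fun u hu => ?_⟩
    · split_ifs <;> norm_num
    · split_ifs <;> norm_num
    · rw [deg_zero, nbrSum_zero, if_neg hu, ← Finset.add_sum_erase _ _ (Finset.mem_univ v), if_pos rfl,
        Finset.sum_congr rfl fun w hw => if_neg (Finset.ne_of_mem_erase hw), Finset.sum_const,
        Finset.card_erase_of_mem (Finset.mem_univ v), Finset.card_univ, card_node]
      norm_num
  | succ g ih =>
    have hold : ∀ v : Node g, ∃ F,
        IsHittingBound (network (g + 1)) (old v) (1 + 9 / 5 * (31 * 3 ^ g)) F := fun v => by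
      obtain ⟨f, hf⟩ := ih v
      exact isHittingBound_old hf
    have h3 : (1 : ℝ) ≤ 3 ^ g := one_le_pow₀ (by norm_num)
    revert v
    refine node_cases (fun v => ?_) fun t => ?_
    · obtain ⟨F, hF⟩ := hold v
      refine ⟨F, hF.mono ?_⟩
      rw [pow_succ]
      linarith
    · obtain ⟨f, hf⟩ := exists_isHittingTime_network (g + 1) (new t)
      obtain ⟨h, hh⟩ := hold (corner g t 0)
      -- From the corner, `new t` is hit in at most `36 * 3 ^ g - 3` steps by the return-time
      -- identity. With a constant `K`, the recursion is safe once `36 + 9 / 5 * K ≤ 3 * K`, that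
      -- is, `K ≥ 30`.
      refine ⟨_, (hf.isHittingBound_min (deg_pos (g + 1)) hh).mono ?_⟩
      have h1 := hf.nbrSum_target
      rw [nbrSum_new, deg_new, sum_deg, Fin.sum_univ_three, pow_succ] at h1
      rw [pow_succ]
      linarith [hf.nonneg (old (corner g t 1)), hf.nonneg (old (corner g t 2))]

/-! ### Nodes of the last iteration take time of order `3 ^ g` to hit. -/

theorem adj_corner (g : ℕ) (t : Tri g) {i j : Fin 3} (hij : i ≠ j) :
    (network g).Adj (corner g t i) (corner g t j) := by
  induction g with
  | zero => exact (corner_injective 0 t).ne hij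
  | succ g ih =>
    obtain ⟨t, k⟩ := t
    rw [corner_succ, corner_succ]
    split_ifs with hi hj hj
    · exact absurd (hi.trans hj.symm) hij
    · exact adj_new_old.2 ⟨j, rfl⟩
    · exact (adj_new_old.2 ⟨i, rfl⟩).symm
    · exact ih t

/-- A node of degree three with mutually adjacent neighbours is hard to hit from everywhere. -/
theorem le_of_isHittingTime_new {g : ℕ} {t : Tri g} {f : Node (g + 1) → ℝ}
    (hf : IsHittingTime (network (g + 1)) (new t) f) (x : Node (g + 1)) (hx : x ≠ new t) :
    9 / 4 * 3 ^ (g + 1) ≤ f x := by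
  classical
  obtain ⟨m, hadj, hmin⟩ := hf.exists_adj_forall_le (deg_pos (g + 1))
  obtain ⟨i, rfl⟩ : ∃ i, m = old (corner g t i) := by
    revert m
    refine node_cases (fun u h _ => ?_) fun s h => h.elim
    obtain ⟨i, rfl⟩ := adj_new_old.1 h
    exact ⟨i, rfl⟩
  set m := old (corner g t i) with hm
  have hinj : ∀ j k, old (corner g t j) = old (corner g t k) ↔ j = k := fun j k =>
    (old_injective.comp (corner_injective g t)).eq_iff
  -- The corner `m` minimises `f` off the target. Around `m`, keep the exact values at the target
  -- and the corners and use `f m` elsewhere. The first-step equation then gives `4 * f m ≥ (∑ j, f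
  -- (old (corner g t j))) + deg m`, where the sum is `12 * 3 ^ (g + 1) - 3`; the slack between `3`
  -- and `9 / 4` absorbs the `-3`.
  have hle : nbrSum (network (g + 1)) (fun w => f m + ((if w = new t then -f m else 0) +
      ∑ j, if w = old (corner g t j) then f (old (corner g t j)) - f m else 0)) m ≤
      nbrSum (network (g + 1)) f m := by
    refine nbrSum_mono _ _ fun w _ => ?_
    by_cases hw : w = new t
    · subst hw
      simp [(old_ne_new _ _).symm, hf.target]
    · by_cases hc : ∃ k, w = old (corner g t k)
      · obtain ⟨k, rfl⟩ := hc
        simp [hinj, old_ne_new]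
      · push Not at hc
        simpa [hw, hc] using hmin w hw
  have hadj' : ∀ j, (if (network (g + 1)).Adj m (old (corner g t j)) then
      f (old (corner g t j)) - f m else 0) = f (old (corner g t j)) - f m := by
    intro j
    by_cases hj : i = j
    · rw [← hj, ← hm, sub_self, ite_self]
    · exact if_pos (adj_corner g t hj)
  rw [nbrSum_add, nbrSum_const, nbrSum_add, nbrSum_ite_eq, nbrSum_sum, if_pos hadj.symm] at hle
  simp only [nbrSum_ite_eq, hadj', Finset.sum_sub_distrib, Finset.sum_const] at hle
  have h1 := hf.nbrSum_target
  rw [nbrSum_new, deg_new, sum_deg] at h1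
  rw [h1] at hle
  have h2 := hf.step m (old_ne_new _ _)
  have h3 := deg_pos (g + 1) m
  have h4 : (1 : ℝ) ≤ 3 ^ g := one_le_pow₀ (by norm_num)
  have h5 := hmin x hx
  simp only [Finset.card_univ, Fintype.card_fin, nsmul_eq_mul] at hle
  push_cast at hle
  rw [pow_succ] at hle ⊢
  linarith

/-! ### The cover time of the networks. -/

theorem one_le_log_card (g : ℕ) : 1 ≤ Real.log (Fintype.card (Node g)) := by
  have h3 : (1 : ℝ) ≤ 3 ^ g := one_le_pow₀ (by norm_num)
  rw [card_node, Real.le_log_iff_exp_le (by positivity)]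
  push_cast
  linarith [Real.exp_one_lt_d9]

theorem coverTime_le (g : ℕ) :
    coverTime (network g) ≤ ENNReal.ofReal
      (31 * ((Fintype.card (Node g) : ℝ) * Real.log (Fintype.card (Node g) : ℝ))) := by
  choose f hf using exists_isHittingBound g
  refine iSup_le fun u => (coverTimeFrom_le_mul_harmonic _ (deg_pos g) f (31 * 3 ^ g)
    (fun b => (hf b).nonneg) (fun b => (hf b).target) (fun b => (hf b).le)
    (fun b => (hf b).step) u).trans (ENNReal.ofReal_le_ofReal ?_)
  have h1 := harmonic_le_one_add_log (Fintype.card (Node g))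
  have h2 := one_le_log_card g
  have h3 : (Fintype.card (Node g) : ℝ) = 2 * 3 ^ g + 2 := by rw [card_node]; push_cast; rfl
  calc 31 * 3 ^ g * (harmonic (Fintype.card (Node g)) : ℝ)
      ≤ 31 * 3 ^ g * (2 * Real.log (Fintype.card (Node g))) := by
        gcongr
        linarith
    _ = 31 * (2 * 3 ^ g * Real.log (Fintype.card (Node g))) := by ring
    _ ≤ _ := by
        gcongr
        linarith

/-- The tetrahedron has no added nodes to serve as hard targets; a single target, at least one step
away, suffices. -/
theorem le_coverTime_zero : 1 ≤ coverTime (network 0) := by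
  choose f hf using exists_isHittingTime_network 0
  obtain ⟨u, b, hub⟩ := Fintype.exists_pair_of_one_lt_card (α := Node 0) (by rw [card_node]; simp)
  have h := mul_harmonic_le_coverTimeFrom _ (deg_pos 0) f {b} (Finset.singleton_nonempty _) 1
    zero_le_one (fun b => (hf b).nonneg) (fun b => (hf b).target)
    (fun b _ a hab => (hf b).one_le (deg_pos 0) hab) (fun b u hu => ((hf b).step u hu).le)
    u (by simpa using hub)
  refine le_trans ?_ (h.trans (le_iSup (coverTimeFrom (network 0)) u))
  rw [Finset.card_singleton]
  simp [harmonic]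

theorem le_coverTime_succ (g : ℕ) :
    ENNReal.ofReal (9 / 4 * 3 ^ (g + 1) * Real.log (4 * 3 ^ g + 1)) ≤
      coverTime (network (g + 1)) := by
  classical
  choose f hf using exists_isHittingTime_network (g + 1)
  obtain ⟨u⟩ := (network_connected g).nonempty
  have hcard : (Finset.univ.image (new (g := g))).card = 4 * 3 ^ g := by
    rw [Finset.card_image_of_injective _ new_injective, Finset.card_univ, card_tri]
  have hlog := log_add_one_le_harmonic (4 * 3 ^ g)
  push_cast at hlog
  have h := mul_harmonic_le_coverTimeFrom _ (deg_pos (g + 1)) f (Finset.univ.image new)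
    (Finset.card_pos.1 (by rw [hcard]; positivity)) (9 / 4 * 3 ^ (g + 1)) (by positivity)
    (fun b => (hf b).nonneg) (fun b => (hf b).target) (fun b hb a hab => ?_)
    (fun b u hu => ((hf b).step u hu).le) (old u) ?_
  · refine le_trans (ENNReal.ofReal_le_ofReal ?_) (h.trans (le_iSup _ (old u)))
    rw [hcard]
    gcongr
  · obtain ⟨t, _, rfl⟩ := Finset.mem_image.1 hb
    exact le_of_isHittingTime_new (hf _) a hab
  · simp [(old_ne_new _ _).symm]

theorem le_coverTime (g : ℕ) :
    ENNReal.ofReal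
      (1 / 12 * ((Fintype.card (Node g) : ℝ) * Real.log (Fintype.card (Node g) : ℝ))) ≤
      coverTime (network g) := by
  cases g with
  | zero =>
    refine le_trans ?_ le_coverTime_zero
    rw [ENNReal.ofReal_le_one, card_node]
    -- The estimate `log 4 ≤ 3` turns `1 / 12 * (4 * log 4)` into at most `1`; this case dictates
    -- the constant `1 / 12`, and the others leave ample room.
    have h := Real.log_le_sub_one_of_pos (show (0 : ℝ) < 4 by norm_num)
    norm_num
    linarith
  | succ g =>
    refine le_trans (ENNReal.ofReal_le_ofReal ?_) (le_coverTime_succ g)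
    have h3 : (1 : ℝ) ≤ 3 ^ g := one_le_pow₀ (by norm_num)
    have hN : (Fintype.card (Node (g + 1)) : ℝ) = 6 * 3 ^ g + 2 := by
      rw [card_node, pow_succ]; push_cast; ring
    have hlog : Real.log (6 * 3 ^ g + 2) ≤ 2 * Real.log (4 * 3 ^ g + 1) := by
      have h : Real.log ((4 * 3 ^ g + 1) ^ 2) = 2 * Real.log (4 * 3 ^ g + 1) := by
        rw [Real.log_pow, Nat.cast_two]
      rw [← h]
      exact Real.log_le_log (by positivity) (by nlinarith)
    have hpos : 0 ≤ Real.log (4 * 3 ^ g + 1) := Real.log_nonneg (by linarith)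
    rw [hN]
    calc 1 / 12 * ((6 * 3 ^ g + 2) * Real.log (6 * 3 ^ g + 2))
        ≤ 1 / 12 * ((8 * 3 ^ g) * (2 * Real.log (4 * 3 ^ g + 1))) := by
          gcongr
          · exact Real.log_nonneg (by linarith)
          · linarith
      _ = 4 / 3 * 3 ^ g * Real.log (4 * 3 ^ g + 1) := by ring
      _ ≤ _ := by
          gcongr ?_ * _
          rw [pow_succ]
          linarith

end Apollonian

theorem mainTheorem1 :
    (∀ g : ℕ, Fintype.card (Apollonian.Node g) = 2 * 3 ^ g + 2) ∧
    ∃ c C : ℝ, 0 < c ∧ 0 < C ∧ ∀ g : ℕ,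
      ENNReal.ofReal (c * ((Fintype.card (Apollonian.Node g) : ℝ) *
          Real.log (Fintype.card (Apollonian.Node g) : ℝ))) ≤
        RandomWalk.coverTime (Apollonian.network g) ∧
      RandomWalk.coverTime (Apollonian.network g) ≤
        ENNReal.ofReal (C * ((Fintype.card (Apollonian.Node g) : ℝ) *
          Real.log (Fintype.card (Apollonian.Node g) : ℝ))) :=
  ⟨Apollonian.card_node, 1 / 12, 31, by norm_num, by norm_num, fun g =>
    ⟨Apollonian.le_coverTime g, Apollonian.coverTime_le g⟩⟩
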